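/- Let $n\ge 2$, let $z\in\mathbb{C}^n$ be a deterministic vector with $|z_i|=1$ for all $i$, let $\sigma\ge 0$, and let $W\in\mathbb{C}^{n\times n}$ be a Hermitian Gaussian Wigner matrix, i.e. a random Hermitian matrix with zero diagonal whose entries above the diagonal are i.i.d. standard complex normal (independent real and imaginary parts, each $\mathcal N(0,1/2)$, so $\mathbb{E}|W_{ij}|^2=1$). Put $C=zz^*+\sigma W$ and consider $$\text{(QP)}\quad \max_{x\in\mathbb{C}^n} x^*Cx \ \text{ subject to } |x_1|=\cdots=|x_n|=1,$$ $$\text{(SDP)}\quad \max_{X\in\mathbb{C}^{n\times n}} \operatorname{trace}(CX)\ \text{ subject to } X_{ii}=1 \ (1\le i\le n),\ X\succeq 0 .$$ There is an absolute constant $K$ (independent of $n$, $z$ and $\sigma$) such that, with probability at least $1-Kn^{-5/4}$, the following holds for every global optimizer $x$ of (QP) with $z^*x=|z^*x|$: $$\|x-z\|_\infty\le 6\left(\sqrt{\log n}+29\sigma\right)\sigma n^{-1/2}\qquad\text{and}\qquad \|x-z\|_2\le 12\sigma ,$$ and if furthermore $\sigma\le \frac1{18}n^{1/4}$, then (SDP)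 has the rank-one matrix $X=xx^*$ as its unique solution. -/

import Mathlib

open MeasureTheory ProbabilityTheory
open scoped Matrix NNReal ComplexOrder

namespace AngularSync

/-- The standard complex normal distribution on `ℂ`: independent real and imaginary parts, each
centred Gaussian with variance `1/2`, so that `𝔼 |w|² = 1`. -/
noncomputable def stdComplexGaussian : Measure ℂ :=
  ((gaussianReal 0 (1 / 2 : ℝ≥0)).prod (gaussianReal 0 (1 / 2 : ℝ≥0))).map
    (fun p : ℝ × ℝ => (⟨p.1, p.2⟩ : ℂ))

/-- `W` is a Hermitian (complex) Gaussian Wigner matrix under `μ`: it is a Hermitian random matrix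
with zero diagonal whose entries above the diagonal are i.i.d. standard complex normal. -/
structure IsGaussianWigner {Ω : Type*} [MeasurableSpace Ω] (μ : Measure Ω) {n : ℕ}
    (W : Ω → Matrix (Fin n) (Fin n) ℂ) : Prop where
  isHermitian : ∀ ω, (W ω).IsHermitian
  diag_eq_zero : ∀ ω i, W ω i i = 0
  hasLaw : ∀ i j, i < j → HasLaw (fun ω => W ω i j) stdComplexGaussian μ
  iIndepFun : iIndepFun
    (fun (p : {p : Fin n × Fin n // p.1 < p.2}) (ω : Ω) => W ω p.1.1 p.1.2) μ

/-- The rank-one matrix `x x*`. -/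
def outer {n : ℕ} (x : Fin n → ℂ) : Matrix (Fin n) (Fin n) ℂ :=
  Matrix.vecMulVec x (star x)

/-- The data matrix `C = z z* + σ W`. -/
noncomputable def dataMatrix {n : ℕ} (z : Fin n → ℂ) (σ : ℝ) (W : Matrix (Fin n) (Fin n) ℂ) :
    Matrix (Fin n) (Fin n) ℂ :=
  outer z + (σ : ℂ) • W

/-- The feasible set of (QP): vectors all of whose entries have unit modulus. -/
def phaseVectors (n : ℕ) : Set (Fin n → ℂ) := {x | ∀ i, ‖x i‖ = 1}

/-- `x` is a global optimizer of (QP): maximize `x* C x` subject to `|x_i| = 1` for all `i`.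
The objective is real for Hermitian `C`, so taking its real part loses nothing. -/
def IsQPSolution {n : ℕ} (C : Matrix (Fin n) (Fin n) ℂ) (x : Fin n → ℂ) : Prop :=
  x ∈ phaseVectors n ∧ IsMaxOn (fun y : Fin n → ℂ => (star y ⬝ᵥ (C *ᵥ y)).re) (phaseVectors n) x

/-- The feasible set of (SDP): Hermitian positive semidefinite matrices with unit diagonal. -/
def sdpFeasible (n : ℕ) : Set (Matrix (Fin n) (Fin n) ℂ) :=
  {X | X.PosSemidef ∧ ∀ i, X i i = 1}

/-- `X` is a global optimizer of (SDP): maximize `trace (C X)` subject to `diag X = 1`, `X ⪰ 0`.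
The objective is real for Hermitian `C` and `X`, so taking its real part loses nothing. -/
def IsSDPSolution {n : ℕ} (C X : Matrix (Fin n) (Fin n) ℂ) : Prop :=
  X ∈ sdpFeasible n ∧
    IsMaxOn (fun Y : Matrix (Fin n) (Fin n) ℂ => (C * Y).trace.re) (sdpFeasible n) X

end AngularSync

/-! All the randomness enters through two facts about `W`, collected in `IsDiscordant`: the operator
norm of `W` is at most `3√n`, and every entry of `W z` is at most `3√(n log n)` in modulus. The rest
is deterministic.

Probability. Real parts of linear forms in the entries of `W` are sub-Gaussian with parameter the
squared Frobenius norm of the coefficients. This handles `W z` directly. For the operator norm, a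
volume argument replaces nets: around a top eigenvector, a fraction of about `0.0784 ^ n` of the
unit ball has quadratic form at least `0.8 ‖W‖`, while each point of the ball has a large quadratic
form only with Gaussian-small probability. Fubini compares the two.

Estimation. Write `g = |z*x|` and `e = ‖x - z‖₂`, so `e² = 2(n - g)`. Comparing the objective at `x`
and at `z` gives `e ≤ 12σ`. As `x` depends on `W`, the entries of `W x` are controlled by splitting
`x = z + (x - z)`. Coordinatewise optimality gives `C x = diag(d) x` with `d ≥ 0`, and then `d_i x_i
= g z_i + σ (W x)_i` yields the sup-norm bound.

Tightness. `S = diag(d) - C` kills `x`. On the orthogonal complement of `x` it is positive definite,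
because there `z*v = -(x - z)*v` is small and every `d_i` is close to `g ≈ n`. Such a dual
certificate forces `x x*` to be the unique solution of (SDP). -/

namespace AngularSync

/-! ### Sub-Gaussian tails for linear and quadratic forms in `W` -/

lemma hasSubgaussianMGF_re_mul (a : ℂ) :
    HasSubgaussianMGF (fun w : ℂ => (a * w).re) (‖a‖₊ ^ 2 / 2) stdComplexGaussian := by
  have hm : Measurable (fun p : ℝ × ℝ => (⟨p.1, p.2⟩ : ℂ)) :=
    Complex.measurableEquivRealProd.symm.measurable
  have hX : ∀ b t : ℝ, Integrable (fun x : ℝ => Real.exp (t * b * x))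
      (gaussianReal 0 (1 / 2 : ℝ≥0)) := fun b t => integrable_exp_mul_gaussianReal _
  have hI : ∀ b t : ℝ, ∫ x, Real.exp (t * b * x) ∂(gaussianReal 0 (1 / 2 : ℝ≥0))
      = Real.exp ((t * b) ^ 2 / 4) := by
    intro b t
    have h := congrFun (mgf_id_gaussianReal (μ := 0) (v := (1 / 2 : ℝ≥0))) (t * b)
    simp only [mgf, id] at h
    rw [h]
    congr 1
    push_cast
    ring
  have he : ∀ t : ℝ, ∀ p : ℝ × ℝ, Real.exp (t * (a * (⟨p.1, p.2⟩ : ℂ)).re)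
      = Real.exp (t * a.re * p.1) * Real.exp (t * (-a.im) * p.2) := by
    intro t p
    rw [← Real.exp_add, Complex.mul_re]
    congr 1
    ring
  have hmeas : ∀ t : ℝ, Measurable fun w : ℂ => Real.exp (t * (a * w).re) := fun t =>
    (Real.continuous_exp.comp (continuous_const.mul
      (Complex.continuous_re.comp (continuous_const.mul continuous_id)))).measurable
  constructor
  · intro t
    rw [stdComplexGaussian, integrable_map_measure (hmeas t).aestronglyMeasurable hm.aemeasurable]
    refine ((hX a.re t).mul_prod (hX (-a.im) t)).congr (Filter.Eventually.of_forall fun p => ?_)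
    exact (he t p).symm
  · intro t
    rw [mgf, stdComplexGaussian, integral_map hm.aemeasurable (hmeas t).aestronglyMeasurable]
    simp only [he]
    rw [integral_prod_mul (fun x => Real.exp (t * a.re * x)) (fun x => Real.exp (t * (-a.im) * x)),
      hI, hI, ← Real.exp_add]
    apply Real.exp_le_exp.mpr
    have h1 : ((‖a‖₊ ^ 2 / 2 : ℝ≥0) : ℝ) = (a.re ^ 2 + a.im ^ 2) / 2 := by
      push_cast
      rw [Complex.sq_norm, Complex.normSq_apply]
      ring
    rw [h1]
    apply le_of_eq
    ring

lemma sum_sum_eq_sum_lt {n : ℕ} {M : Type*} [AddCommMonoid M] (F : Fin n → Fin n → M) :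
    ∑ i, ∑ j, F i j = (∑ p : {p : Fin n × Fin n // p.1 < p.2},
      (F p.1.1 p.1.2 + F p.1.2 p.1.1)) + ∑ i, F i i := by
  have h : ∀ f : Fin n × Fin n → M, ∑ p : {p : Fin n × Fin n // p.1 < p.2}, f p.1
      = ∑ i, ∑ j, if i < j then f (i, j) else 0 := by
    intro f
    rw [← Finset.sum_subtype (Finset.univ.filter fun p : Fin n × Fin n => p.1 < p.2)
      (by simp) f, Finset.sum_filter, Fintype.sum_prod_type]
  rw [Finset.sum_add_distrib, h fun p => F p.1 p.2, h fun p => F p.2 p.1,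
    Finset.sum_comm (f := fun i j => if i < j then F j i else 0), ← Finset.sum_add_distrib,
    ← Finset.sum_add_distrib]
  refine Finset.sum_congr rfl fun i _ => ?_
  rw [← Finset.sum_add_distrib]
  have hd : F i i = ∑ j, if i = j then F i j else 0 := by simp
  rw [hd, ← Finset.sum_add_distrib]
  refine Finset.sum_congr rfl fun j _ => ?_
  rcases lt_trichotomy i j with h | h | h
  · simp [h, h.ne, h.le.not_gt]
  · simp [h]
  · simp [h, h.ne', h.le.not_gt]

variable {Ω : Type*} [MeasurableSpace Ω] {μ : Measure Ω} {n : ℕ}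
  {W : Ω → Matrix (Fin n) (Fin n) ℂ}

lemma HasSubgaussianMGF.mono {X : Ω → ℝ} {c d : ℝ≥0} (h : HasSubgaussianMGF X c μ)
    (hcd : c ≤ d) : HasSubgaussianMGF X d μ :=
  ⟨h.1, fun t => (h.2 t).trans (Real.exp_le_exp.mpr (by gcongr))⟩

lemma IsGaussianWigner.conj_apply (hW : IsGaussianWigner μ W) (ω : Ω) (i j : Fin n) :
    W ω j i = star (W ω i j) := ((hW.isHermitian ω).apply j i).symm

/-- Since `W j i` is the conjugate of `W i j`, the two terms merge into the real part of `(A i j +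
star (A j i)) * W i j`, leaving an independent sum over `i < j`. The parameter follows from `|a +
b|² / 2 ≤ |a|² + |b|²`. -/
lemma IsGaussianWigner.hasSubgaussianMGF_sum (hW : IsGaussianWigner μ W)
    (A : Fin n → Fin n → ℂ) :
    HasSubgaussianMGF (fun ω => (∑ i, ∑ j, A i j * W ω i j).re)
      (∑ i, ∑ j, ‖A i j‖₊ ^ 2) μ := by
  have h1 : ∀ ω, (∑ i, ∑ j, A i j * W ω i j).re
      = ∑ p : {p : Fin n × Fin n // p.1 < p.2},
        ((A p.1.1 p.1.2 + star (A p.1.2 p.1.1)) * W ω p.1.1 p.1.2).re := by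
    intro ω
    rw [sum_sum_eq_sum_lt]
    simp only [hW.diag_eq_zero, mul_zero, Finset.sum_const_zero, add_zero, Complex.re_sum]
    refine Finset.sum_congr rfl fun p _ => ?_
    rw [hW.conj_apply ω p.1.1 p.1.2]
    simp [Complex.mul_re]
    ring
  have hind : ProbabilityTheory.iIndepFun (fun (p : {p : Fin n × Fin n // p.1 < p.2}) (ω : Ω) =>
      ((A p.1.1 p.1.2 + star (A p.1.2 p.1.1)) * W ω p.1.1 p.1.2).re) μ :=
    hW.iIndepFun.comp (fun p w => ((A p.1.1 p.1.2 + star (A p.1.2 p.1.1)) * w).re)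
      fun p => (Complex.continuous_re.comp (continuous_const.mul continuous_id)).measurable
  have h2 := HasSubgaussianMGF.sum_of_iIndepFun hind (s := Finset.univ)
    (c := fun p => ‖A p.1.1 p.1.2 + star (A p.1.2 p.1.1)‖₊ ^ 2 / 2) fun p _ => by
      have hl := hW.hasLaw p.1.1 p.1.2 p.2
      exact HasSubgaussianMGF.of_map (X := fun w : ℂ =>
        ((A p.1.1 p.1.2 + star (A p.1.2 p.1.1)) * w).re) hl.aemeasurable
        (hl.map_eq ▸ hasSubgaussianMGF_re_mul _)
  simp only [h1]
  refine HasSubgaussianMGF.mono h2 ?_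
  rw [sum_sum_eq_sum_lt (fun i j => ‖A i j‖₊ ^ 2)]
  refine le_add_right (Finset.sum_le_sum fun p _ => ?_)
  rw [← NNReal.coe_le_coe]
  push_cast
  have h3 := norm_add_le (A p.1.1 p.1.2) (star (A p.1.2 p.1.1))
  rw [norm_star] at h3
  have h4 := norm_nonneg (A p.1.1 p.1.2 + star (A p.1.2 p.1.1))
  nlinarith [sq_nonneg (‖A p.1.1 p.1.2‖ - ‖A p.1.2 p.1.1‖)]

lemma IsGaussianWigner.measureReal_re_sum_ge_le (hW : IsGaussianWigner μ W)
    (A : Fin n → Fin n → ℂ) {c t : ℝ} (hA : ∑ i, ∑ j, ‖A i j‖ ^ 2 ≤ c) (ht : 0 ≤ t) :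
    μ.real {ω | t ≤ (∑ i, ∑ j, A i j * W ω i j).re} ≤ Real.exp (-t ^ 2 / (2 * c)) := by
  have hc : 0 ≤ c := le_trans (by positivity) hA
  lift c to ℝ≥0 using hc
  refine HasSubgaussianMGF.measure_ge_le
    (HasSubgaussianMGF.mono (hW.hasSubgaussianMGF_sum A) ?_) ht
  rw [← NNReal.coe_le_coe]
  push_cast
  exact hA

lemma IsGaussianWigner.measureReal_abs_re_sum_ge_le [IsFiniteMeasure μ]
    (hW : IsGaussianWigner μ W)
    (A : Fin n → Fin n → ℂ) {c t : ℝ} (hA : ∑ i, ∑ j, ‖A i j‖ ^ 2 ≤ c) (ht : 0 ≤ t) :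
    μ.real {ω | t ≤ |(∑ i, ∑ j, A i j * W ω i j).re|} ≤ 2 * Real.exp (-t ^ 2 / (2 * c)) := by
  have h1 := hW.measureReal_re_sum_ge_le A hA ht
  have h2 := hW.measureReal_re_sum_ge_le (fun i j => - A i j) (by simpa using hA) ht
  have h3 : {ω | t ≤ |(∑ i, ∑ j, A i j * W ω i j).re|} ⊆
      {ω | t ≤ (∑ i, ∑ j, A i j * W ω i j).re} ∪
      {ω | t ≤ (∑ i, ∑ j, (- A i j) * W ω i j).re} := by
    intro ω hω
    simpa [le_abs] using hω
  calc _ ≤ _ := measureReal_mono h3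
    _ ≤ _ := measureReal_union_le _ _
    _ ≤ _ := by linarith

lemma quadForm_eq_sum (M : Matrix (Fin n) (Fin n) ℂ) (x : Fin n → ℂ) :
    star x ⬝ᵥ (M *ᵥ x) = ∑ i, ∑ j, (star (x i) * x j) * M i j := by
  simp only [dotProduct, Matrix.mulVec, Finset.mul_sum, Pi.star_apply]
  refine Finset.sum_congr rfl fun i _ => Finset.sum_congr rfl fun j _ => ?_
  ring

lemma IsGaussianWigner.measureReal_abs_quadForm_ge_le [IsFiniteMeasure μ]
    (hW : IsGaussianWigner μ W) (x : EuclideanSpace ℂ (Fin n)) (hx : ‖x‖ ≤ 1) {t : ℝ}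
    (ht : 0 ≤ t) :
    μ.real {ω | t ≤ |(star x.ofLp ⬝ᵥ (W ω *ᵥ x.ofLp)).re|} ≤ 2 * Real.exp (-t ^ 2 / 2) := by
  have hA : ∑ i, ∑ j, ‖star (x i) * x j‖ ^ 2 ≤ 1 := by
    have : ∑ i, ∑ j, ‖star (x i) * x j‖ ^ 2 = ‖x‖ ^ 2 * ‖x‖ ^ 2 := by
      simp only [norm_mul, norm_star, mul_pow, ← Finset.mul_sum, ← Finset.sum_mul]
      rw [EuclideanSpace.norm_sq_eq]
    rw [this]
    have := pow_le_one₀ (n := 2) (norm_nonneg x) hx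
    nlinarith [sq_nonneg ‖x‖]
  have h := hW.measureReal_abs_re_sum_ge_le _ hA ht
  simp only [quadForm_eq_sum]
  simpa using h

lemma IsGaussianWigner.measureReal_norm_mulVec_gt_le [IsFiniteMeasure μ]
    (hW : IsGaussianWigner μ W) {z : Fin n → ℂ} (hz : ∀ i, ‖z i‖ = 1) (i : Fin n) {t : ℝ}
    (ht : 0 ≤ t) :
    μ.real {ω | t < ‖(W ω *ᵥ z) i‖} ≤ 4 * Real.exp (-t ^ 2 / (4 * n)) := by
  have key : ∀ u : ℂ, ‖u‖ = 1 →
      μ.real {ω | t / √2 ≤ |(u * (W ω *ᵥ z) i).re|} ≤ 2 * Real.exp (-t ^ 2 / (4 * n)) := by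
    intro u hu
    have hA : ∑ j, ∑ k, ‖if j = i then u * z k else 0‖ ^ 2 ≤ (n : ℝ) := by
      have : ∀ j, ∑ k, ‖if j = i then u * z k else 0‖ ^ 2 = if j = i then (n : ℝ) else 0 := by
        intro j
        split_ifs <;> simp [hu, hz]
      simp [this]
    have h := hW.measureReal_abs_re_sum_ge_le _ hA (t := t / √2) (by positivity)
    have h2 : ∀ ω, ∑ j, ∑ k, (if j = i then u * z k else 0) * W ω j k = u * (W ω *ᵥ z) i := by
      intro ω
      rw [Finset.sum_eq_single i (fun j _ hj => by simp [hj]) (by simp)]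
      simp only [if_true, Matrix.mulVec, dotProduct, Finset.mul_sum]
      exact Finset.sum_congr rfl fun k _ => by ring
    simp only [h2] at h
    have h3 : -(t / √2) ^ 2 / (2 * (n : ℝ)) = -t ^ 2 / (4 * n) := by
      rw [div_pow, Real.sq_sqrt (by norm_num), ← neg_div, div_div]
      ring
    rwa [h3] at h
  -- A complex number of modulus above `t` has real or imaginary part at least `t / √2` in absolute
  -- value. These are the directions `u = 1` and `u = I`.
  have h3 : {ω | t < ‖(W ω *ᵥ z) i‖} ⊆ {ω | t / √2 ≤ |((1 : ℂ) * (W ω *ᵥ z) i).re|} ∪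
      {ω | t / √2 ≤ |(Complex.I * (W ω *ᵥ z) i).re|} := by
    intro ω hω
    by_contra hcon
    simp only [Set.mem_union, Set.mem_ofPred_eq, not_or, not_le, one_mul, Complex.I_mul_re,
      abs_neg] at hcon hω
    obtain ⟨ha, hb⟩ := hcon
    have e : ‖(W ω *ᵥ z) i‖ ^ 2 = |((W ω *ᵥ z) i).re| ^ 2 + |((W ω *ᵥ z) i).im| ^ 2 := by
      rw [Complex.sq_norm, Complex.normSq_apply, sq_abs, sq_abs]; ring
    have e2 : (t / √2) ^ 2 = t ^ 2 / 2 := by rw [div_pow, Real.sq_sqrt (by norm_num)]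
    have ha' := pow_le_pow_left₀ (abs_nonneg _) ha.le 2
    have hb' := pow_le_pow_left₀ (abs_nonneg _) hb.le 2
    have := pow_lt_pow_left₀ hω ht (n := 2) (by norm_num)
    linarith
  calc _ ≤ _ := measureReal_mono h3
    _ ≤ _ := measureReal_union_le _ _
    _ ≤ _ := by linarith [key 1 (by simp), key Complex.I (by simp)]

/-- The hypotheses give only a.e. measurable entries, whereas the Fubini argument below needs joint
measurability in `ω` and the vector. -/
lemma IsGaussianWigner.exists_measurable_ae_eq [IsProbabilityMeasure μ]
    (hW : IsGaussianWigner μ W) :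
    ∃ W' : Ω → Matrix (Fin n) (Fin n) ℂ, IsGaussianWigner μ W' ∧
      (∀ i j, Measurable fun ω => W' ω i j) ∧ W =ᵐ[μ] W' := by
  classical
  have hm : ∀ i j, i < j → ∃ f : Ω → ℂ, Measurable f ∧ (fun ω => W ω i j) =ᵐ[μ] f :=
    fun i j h => ⟨_, (hW.hasLaw i j h).aemeasurable.measurable_mk,
      (hW.hasLaw i j h).aemeasurable.ae_eq_mk⟩
  choose! f hf hWf using hm
  let W' : Ω → Matrix (Fin n) (Fin n) ℂ := fun ω => Matrix.of fun i j =>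
    if i < j then f i j ω else if j < i then star (f j i ω) else 0
  have hlt : ∀ i j, i < j → ∀ ω, W' ω i j = f i j ω := fun i j h ω => by simp [W', h]
  have hgt : ∀ i j, j < i → ∀ ω, W' ω i j = star (f j i ω) := fun i j h ω => by
    simp [W', h, h.le.not_gt]
  have hdiag : ∀ ω i, W' ω i i = 0 := fun ω i => by simp [W']
  refine ⟨W', ⟨?_, hdiag, ?_, ?_⟩, ?_, ?_⟩
  · intro ω
    ext i j
    rw [Matrix.conjTranspose_apply]
    rcases lt_trichotomy i j with h | h | h
    · rw [hlt i j h, hgt j i h, star_star]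
    · rw [h, hdiag, star_zero]
    · rw [hlt j i h, hgt i j h]
  · intro i j h
    refine (hW.hasLaw i j h).congr ?_
    simp only [hlt i j h]
    exact (hWf i j h).symm
  · refine (iIndepFun_congr fun p => ?_).mp hW.iIndepFun
    simp only [hlt p.1.1 p.1.2 p.2]
    exact hWf p.1.1 p.1.2 p.2
  · intro i j
    rcases lt_trichotomy i j with h | h | h
    · simpa only [hlt i j h] using hf i j h
    · simp only [h, hdiag, measurable_const]
    · simp only [hgt i j h]
      exact continuous_star.measurable.comp (hf j i h)
  · have : ∀ᵐ ω ∂μ, ∀ i j, i < j → W ω i j = f i j ω := by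
      rw [ae_all_iff]; intro i
      rw [ae_all_iff]; intro j
      by_cases h : i < j
      · filter_upwards [hWf i j h] with ω hω _ using hω
      · exact Filter.Eventually.of_forall fun ω h' => absurd h' h
    filter_upwards [this] with ω hω
    ext i j
    rcases lt_trichotomy i j with h | h | h
    · rw [hlt i j h, hω i j h]
    · rw [h, hdiag, hW.diag_eq_zero]
    · rw [hgt i j h, hW.conj_apply ω j i, hω j i h]

end AngularSync

/-! ### Operator norm of `W` by a volume argument -/

namespace AngularSync

lemma exists_eigenvector_forall_norm_le {n : ℕ} (hn : 0 < n) {M : Matrix (Fin n) (Fin n) ℂ}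
    (hM : M.IsHermitian) :
    ∃ (l : ℝ) (v : EuclideanSpace ℂ (Fin n)), ‖v‖ = 1 ∧ Matrix.toEuclideanLin M v = (l : ℂ) • v ∧
      ∀ u, ‖Matrix.toEuclideanLin M u‖ ≤ |l| * ‖u‖ := by
  have hT := Matrix.isSymmetric_toEuclideanLin_iff.mpr hM
  have hd : Module.finrank ℂ (EuclideanSpace ℂ (Fin n)) = n := finrank_euclideanSpace_fin
  set b := hT.eigenvectorBasis hd
  have : Nonempty (Fin n) := ⟨⟨0, hn⟩⟩
  obtain ⟨i, hi⟩ := Finite.exists_max fun i => |hT.eigenvalues hd i|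
  refine ⟨hT.eigenvalues hd i, b i, b.norm_eq_one i, hT.apply_eigenvectorBasis hd i, fun u => ?_⟩
  refine le_of_sq_le_sq ?_ (by positivity)
  rw [mul_pow, ← b.sum_sq_norm_inner_right, ← b.sum_sq_norm_inner_right u, Finset.mul_sum]
  refine Finset.sum_le_sum fun j _ => ?_
  rw [← hT (b j) u, hT.apply_eigenvectorBasis hd j, inner_smul_left, norm_mul, mul_pow]
  gcongr
  simpa using hi j

section

variable {E : Type*} [NormedAddCommGroup E] [InnerProductSpace ℂ E] {T : E →ₗ[ℂ] E} {l : ℝ} {v : E}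

/-- The numbers are tuned so that `0.95² + 2 · 0.95 · 0.01 + 0.28² = 0.9999`. -/
lemma norm_add_lt_one_of_re_inner_le (hv : ‖v‖ = 1) {y : E} (hy : ‖y‖ < 0.28)
    (hvy : |(inner ℂ v y).re| ≤ 0.01) : ‖((0.95 : ℝ) : ℂ) • v + y‖ < 1 := by
  have h1 : ‖((0.95 : ℝ) : ℂ) • v + y‖ ^ 2 = 0.9025 + 1.9 * (inner ℂ v y).re + ‖y‖ ^ 2 := by
    rw [norm_add_sq (𝕜 := ℂ), norm_smul, hv, inner_smul_left, Complex.conj_ofReal,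
      RCLike.re_to_complex, Complex.re_ofReal_mul, Complex.norm_real, Real.norm_eq_abs,
      abs_of_pos (by norm_num)]
    ring
  have h2 := (abs_le.mp hvy).2
  have h3 : ‖y‖ ^ 2 < 0.28 ^ 2 := pow_lt_pow_left₀ hy (norm_nonneg _) (by norm_num)
  refine lt_of_pow_lt_pow_left₀ 2 zero_le_one ?_
  rw [h1]
  norm_num at h2 h3 ⊢
  linarith

/-- On expanding, the terms involving the eigenvector contribute at least `(0.9025 - 0.019)|l| =
0.8835 |l|` in absolute value, and the remaining `⟨y, T y⟩` at most `0.28² |l| = 0.0784 |l|`. -/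
lemma le_abs_re_inner_apply_of_re_inner_le (hT : T.IsSymmetric) (hv : ‖v‖ = 1)
    (hTv : T v = (l : ℂ) • v) (hl : ∀ u, ‖T u‖ ≤ |l| * ‖u‖) {y : E} (hy : ‖y‖ < 0.28)
    (hvy : |(inner ℂ v y).re| ≤ 0.01) :
    0.8 * |l| ≤ |(inner ℂ (((0.95 : ℝ) : ℂ) • v + y) (T (((0.95 : ℝ) : ℂ) • v + y))).re| := by
  have e : (inner ℂ (((0.95 : ℝ) : ℂ) • v + y) (T (((0.95 : ℝ) : ℂ) • v + y))).re
      = l * (0.9025 + 1.9 * (inner ℂ v y).re) + (inner ℂ y (T y)).re := by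
    have h1 : (inner ℂ y v).re = (inner ℂ v y).re := by
      rw [← inner_conj_symm, Complex.conj_re]
    have h2 : inner ℂ v v = (1 : ℂ) := by rw [inner_self_eq_norm_sq_to_K, hv]; simp
    rw [map_add, map_smul, hTv, inner_add_left, inner_add_right, inner_add_right,
      inner_smul_left _ (T y), ← hT v y, hTv]
    simp only [inner_smul_left, inner_smul_right, Complex.conj_ofReal, Complex.add_re,
      Complex.re_ofReal_mul, h1, h2, Complex.one_re]
    ring
  have h3 : |(inner ℂ y (T y)).re| ≤ |l| * 0.0784 := by
    calc _ ≤ ‖inner ℂ y (T y)‖ := Complex.abs_re_le_norm _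
      _ ≤ ‖y‖ * ‖T y‖ := norm_inner_le_norm _ _
      _ ≤ ‖y‖ * (|l| * ‖y‖) := by gcongr; exact hl y
      _ = |l| * (‖y‖ * ‖y‖) := by ring
      _ ≤ |l| * (0.28 * 0.28) := by gcongr
      _ = _ := by norm_num
  have h4 : |l| * 0.8835 ≤ |l * (0.9025 + 1.9 * (inner ℂ v y).re)| := by
    rw [abs_mul]
    gcongr
    refine le_trans ?_ (le_abs_self _)
    have := (abs_le.mp hvy).1
    norm_num at this ⊢
    linarith
  rw [e]
  have h5 := abs_sub_abs_le_abs_sub (l * (0.9025 + 1.9 * (inner ℂ v y).re)) (-(inner ℂ y (T y)).re)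
  rw [sub_neg_eq_add, abs_neg] at h5
  have := abs_nonneg l
  norm_num at h3 h4 h5 ⊢
  linarith

/-- A cap of a ball lies in a smaller ball centred at `d • v`, because `‖y - d v‖² = ‖y‖² - 2 d
Re⟨v, y⟩ + d² < r² - d²`. -/
lemma norm_sub_smul_lt_of_lt_re_inner {d r ρ : ℝ} (hd : 0 < d) (hρ : 0 ≤ ρ)
    (h : r ^ 2 = ρ ^ 2 + d ^ 2) (hv : ‖v‖ = 1) {y : E} (hy : ‖y‖ < r)
    (hvy : d < (inner ℂ v y).re) : ‖y - (d : ℂ) • v‖ < ρ := by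
  have h1 := norm_sub_sq (𝕜 := ℂ) y ((d : ℂ) • v)
  have h2 : (inner ℂ y v).re = (inner ℂ v y).re := by
    rw [← inner_conj_symm, Complex.conj_re]
  rw [norm_smul, hv, inner_smul_right, RCLike.re_to_complex, Complex.re_ofReal_mul, h2,
    Complex.norm_real, mul_one, Real.norm_eq_abs, sq_abs] at h1
  have h3 : ‖y‖ ^ 2 < r ^ 2 := pow_lt_pow_left₀ hy (norm_nonneg _) (by norm_num)
  refine lt_of_pow_lt_pow_left₀ 2 hρ ?_
  nlinarith

end

variable {n : ℕ}

lemma measureReal_ball_euclideanSpace (hn : 0 < n) (x : EuclideanSpace ℂ (Fin n)) {r : ℝ}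
    (hr : 0 ≤ r) : volume.real (Metric.ball x r)
      = (r ^ 2) ^ n * volume.real (Metric.ball (0 : EuclideanSpace ℂ (Fin n)) 1) := by
  have : Nonempty (Fin n) := ⟨⟨0, hn⟩⟩
  have hd : Module.finrank ℝ (EuclideanSpace ℂ (Fin n)) = 2 * n := by
    rw [← Module.finrank_mul_finrank ℝ ℂ]; simp
  rw [measureReal_def, Measure.addHaar_ball _ _ hr, hd, ENNReal.toReal_mul,
    ENNReal.toReal_ofReal (by positivity), pow_mul, measureReal_def]

lemma inner_toEuclideanLin (M : Matrix (Fin n) (Fin n) ℂ) (x : EuclideanSpace ℂ (Fin n)) :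
    inner ℂ x (Matrix.toEuclideanLin M x) = star x.ofLp ⬝ᵥ (M *ᵥ x.ofLp) := by
  rw [EuclideanSpace.inner_eq_star_dotProduct, Matrix.toLpLin_apply, dotProduct_comm]

/-- The good points are those of the ball of radius `0.28` around `0.95 v`, apart from the two caps
`|Re⟨v, y⟩| > 0.01`. Each cap fits in a ball of squared radius `0.28² - 0.01² = 0.0783`. The real
dimension is `2n`, so volumes scale as the `n`-th power of the squared radius. -/
lemma measureReal_ball_quadForm_ge (hn : 0 < n) {M : Matrix (Fin n) (Fin n) ℂ}
    (hM : M.IsHermitian) {t : ℝ} {u : EuclideanSpace ℂ (Fin n)}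
    (hu : t * ‖u‖ < 0.8 * ‖Matrix.toEuclideanLin M u‖) :
    (0.0784 ^ n - 2 * 0.0783 ^ n) *
        volume.real (Metric.ball (0 : EuclideanSpace ℂ (Fin n)) 1) ≤
      volume.real {x : EuclideanSpace ℂ (Fin n) | x ∈ Metric.ball 0 1 ∧
        t ≤ |(star x.ofLp ⬝ᵥ (M *ᵥ x.ofLp)).re|} := by
  obtain ⟨l, v, hv, hTv, hl⟩ := exists_eigenvector_forall_norm_le hn hM
  have hT := Matrix.isSymmetric_toEuclideanLin_iff.mpr hM
  have htl : t ≤ 0.8 * |l| := by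
    have h1 : t * ‖u‖ < 0.8 * |l| * ‖u‖ := by
      calc _ < _ := hu
        _ ≤ 0.8 * (|l| * ‖u‖) := by gcongr; exact hl u
        _ = _ := by ring
    exact (lt_of_mul_lt_mul_right h1 (norm_nonneg _)).le
  set S := {x : EuclideanSpace ℂ (Fin n) | x ∈ Metric.ball 0 1 ∧
        t ≤ |(star x.ofLp ⬝ᵥ (M *ᵥ x.ofLp)).re|}
  set ρ : ℝ := √0.0783 with hρ_def
  have hρ : ρ ^ 2 = 0.0783 := Real.sq_sqrt (by norm_num)
  have hsub : Metric.ball (((0.95 : ℝ) : ℂ) • v) 0.28 ⊆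
      S ∪ (Metric.ball (((0.95 : ℝ) : ℂ) • v + ((0.01 : ℝ) : ℂ) • v) ρ ∪
        Metric.ball (((0.95 : ℝ) : ℂ) • v + ((0.01 : ℝ) : ℂ) • (-v)) ρ) := by
    intro x hx
    set y := x - ((0.95 : ℝ) : ℂ) • v with hy_def
    have hxy : x = ((0.95 : ℝ) : ℂ) • v + y := by rw [hy_def]; abel
    have hy : ‖y‖ < 0.28 := by rwa [mem_ball_iff_norm] at hx
    by_cases hvy : |(inner ℂ v y).re| ≤ 0.01
    · left
      refine ⟨?_, ?_⟩
      · rw [mem_ball_zero_iff, hxy]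
        exact norm_add_lt_one_of_re_inner_le hv hy hvy
      · rw [← inner_toEuclideanLin, hxy]
        exact htl.trans (le_abs_re_inner_apply_of_re_inner_le hT hv hTv hl hy hvy)
    · right
      rw [not_le, lt_abs] at hvy
      rcases hvy with h | h
      · left
        rw [mem_ball_iff_norm, ← sub_sub]
        exact norm_sub_smul_lt_of_lt_re_inner (by norm_num) (Real.sqrt_nonneg _)
          (by rw [hρ]; norm_num) hv hy h
      · right
        rw [mem_ball_iff_norm, ← sub_sub]
        refine norm_sub_smul_lt_of_lt_re_inner (by norm_num) (Real.sqrt_nonneg _)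
          (by rw [hρ]; norm_num) (by rwa [norm_neg]) hy ?_
        rwa [inner_neg_left, Complex.neg_re]
  have hS : volume S ≠ ⊤ :=
    ((measure_mono fun x hx => hx.1).trans_lt (measure_ball_lt_top (x := 0) (r := 1))).ne
  have h1 := measureReal_mono (μ := volume) hsub (by
    finiteness)
  rw [measureReal_ball_euclideanSpace hn _ (by norm_num)] at h1
  have h2 := measureReal_union_le (μ := volume) S
    (Metric.ball (((0.95 : ℝ) : ℂ) • v + ((0.01 : ℝ) : ℂ) • v) ρ ∪
        Metric.ball (((0.95 : ℝ) : ℂ) • v + ((0.01 : ℝ) : ℂ) • (-v)) ρ)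
  have h3 := measureReal_union_le (μ := volume)
    (Metric.ball (((0.95 : ℝ) : ℂ) • v + ((0.01 : ℝ) : ℂ) • v) ρ)
        (Metric.ball (((0.95 : ℝ) : ℂ) • v + ((0.01 : ℝ) : ℂ) • (-v)) ρ)
  rw [measureReal_ball_euclideanSpace hn _ (Real.sqrt_nonneg _),
    measureReal_ball_euclideanSpace hn _ (Real.sqrt_nonneg _), ← hρ_def, hρ] at h3
  norm_num at h1 h2 h3 ⊢
  linarith

variable {Ω : Type*} [MeasurableSpace Ω] {μ : Measure Ω} {W : Ω → Matrix (Fin n) (Fin n) ℂ}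

lemma IsGaussianWigner.measureReal_norm_gt_le [IsProbabilityMeasure μ] (hn : 0 < n)
    (hW : IsGaussianWigner μ W) {t : ℝ} (ht : 0 ≤ t) :
    (0.0784 ^ n - 2 * 0.0783 ^ n) *
      μ.real {ω | ∃ u, t * ‖u‖ < 0.8 * ‖Matrix.toEuclideanLin (W ω) u‖} ≤
      2 * Real.exp (-t ^ 2 / 2) := by
  obtain ⟨W', hW', hmeas, hae⟩ := hW.exists_measurable_ae_eq
  have hcongr : μ.real {ω | ∃ u, t * ‖u‖ < 0.8 * ‖Matrix.toEuclideanLin (W ω) u‖} =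
      μ.real {ω | ∃ u, t * ‖u‖ < 0.8 * ‖Matrix.toEuclideanLin (W' ω) u‖} := by
    refine measureReal_congr ?_
    filter_upwards [hae] with ω hω
    apply propext
    change (∃ u, _) ↔ (∃ u, _)
    rw [hω]
  rw [hcongr]
  set A := {ω | ∃ u, t * ‖u‖ < 0.8 * ‖Matrix.toEuclideanLin (W' ω) u‖}
  -- For small `n` the two caps may outweigh the ball; the claim is then trivial.
  rcases le_or_gt (0.0784 ^ n - 2 * 0.0783 ^ n : ℝ) 0 with hc | hc
  · exact (mul_nonpos_of_nonpos_of_nonneg hc measureReal_nonneg).trans (by positivity)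
  set V := volume.real (Metric.ball (0 : EuclideanSpace ℂ (Fin n)) 1) with hV_def
  have hV : 0 < V := ENNReal.toReal_pos (Metric.measure_ball_pos _ _ one_pos).ne'
    measure_ball_lt_top.ne
  let ν : Measure (EuclideanSpace ℂ (Fin n)) := volume.restrict (Metric.ball 0 1)
  have : IsFiniteMeasure ν := ⟨by simp [ν, measure_ball_lt_top]⟩
  let S : Set (Ω × EuclideanSpace ℂ (Fin n)) :=
    {p | t ≤ |(star p.2.ofLp ⬝ᵥ (W' p.1 *ᵥ p.2.ofLp)).re|}
  have hS : MeasurableSet S := by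
    refine measurableSet_le measurable_const ?_
    simp only [quadForm_eq_sum]
    have : Measurable fun p : Ω × EuclideanSpace ℂ (Fin n) =>
        ∑ i, ∑ j, (star (p.2 i) * p.2 j) * W' p.1 i j := by
      refine Finset.measurable_sum _ fun i _ => Finset.measurable_sum _ fun j _ => ?_
      have hcoord : ∀ i, Measurable fun p : Ω × EuclideanSpace ℂ (Fin n) => p.2 i := fun i =>
        (EuclideanSpace.proj (𝕜 := ℂ) i).continuous.measurable.comp measurable_snd
      exact ((continuous_star.measurable.comp (hcoord i)).mul (hcoord j)).mul
        ((hmeas i j).comp measurable_fst)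
    exact (Complex.continuous_re.abs.measurable).comp this
  -- The measure of `S` is bounded above by slicing at fixed `x` (Gaussian tail), and below by
  -- slicing at fixed `ω` and Markov's inequality (volume bound on the event `A`).
  have hupper : (μ.prod ν) S ≤ ENNReal.ofReal (2 * Real.exp (-t ^ 2 / 2) * V) := by
    rw [Measure.prod_apply_symm hS]
    calc ∫⁻ x, μ ((fun ω => (ω, x)) ⁻¹' S) ∂ν
        ≤ ∫⁻ x, ENNReal.ofReal (2 * Real.exp (-t ^ 2 / 2)) ∂ν := by
          refine lintegral_mono_ae ?_
          refine (ae_restrict_iff' measurableSet_ball).mpr (Filter.Eventually.of_forall ?_)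
          intro x hx
          rw [← ENNReal.ofReal_toReal (measure_ne_top μ _)]
          refine ENNReal.ofReal_le_ofReal ?_
          exact hW'.measureReal_abs_quadForm_ge_le x (mem_ball_zero_iff.mp hx).le ht
      _ = _ := by
          rw [lintegral_const, ENNReal.ofReal_mul (p := 2 * Real.exp (-t ^ 2 / 2)) (by positivity)]
          congr 1
          simp only [ν, Measure.restrict_apply_univ, hV_def, measureReal_def]
          rw [ENNReal.ofReal_toReal measure_ball_lt_top.ne]
  have hlower : ENNReal.ofReal ((0.0784 ^ n - 2 * 0.0783 ^ n) * V) * μ A ≤ (μ.prod ν) S := by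
    rw [Measure.prod_apply hS]
    refine le_trans ?_ (mul_meas_ge_le_lintegral
      (measurable_measure_prodMk_left hS) (ENNReal.ofReal ((0.0784 ^ n - 2 * 0.0783 ^ n) * V)))
    gcongr
    rintro ω ⟨u, hu⟩
    have h1 := measureReal_ball_quadForm_ge hn (hW'.isHermitian ω) hu
    refine (ENNReal.ofReal_le_ofReal h1).trans ?_
    rw [measureReal_def]
    refine ENNReal.ofReal_toReal_le.trans ?_
    have hm : MeasurableSet (Prod.mk ω ⁻¹' S) := measurable_prodMk_left hS
    rw [Measure.restrict_apply hm]
    exact measure_mono fun x hx => ⟨hx.2, hx.1⟩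
  have h := hlower.trans hupper
  rw [← ENNReal.ofReal_toReal (measure_ne_top μ A), ← ENNReal.ofReal_mul (by positivity),
    ENNReal.ofReal_le_ofReal_iff (by positivity)] at h
  rw [measureReal_def]
  refine le_of_mul_le_mul_right ?_ hV
  linarith

end AngularSync

/-! ### Deterministic error bounds for optimizers of (QP) -/

namespace AngularSync

variable {n : ℕ}

lemma norm_star_dotProduct_le (u v : Fin n → ℂ) :
    ‖star u ⬝ᵥ v‖ ≤ ‖WithLp.toLp 2 u‖ * ‖WithLp.toLp 2 v‖ := by
  have h := norm_inner_le_norm (𝕜 := ℂ) (WithLp.toLp 2 u) (WithLp.toLp 2 v)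
  rwa [EuclideanSpace.inner_eq_star_dotProduct, dotProduct_comm] at h

lemma norm_toLp_sq (u : Fin n → ℂ) : ‖WithLp.toLp 2 u‖ ^ 2 = ∑ i, ‖u i‖ ^ 2 :=
  EuclideanSpace.norm_sq_eq _

lemma norm_toLp_of_mem_phaseVectors {x : Fin n → ℂ} (hx : x ∈ phaseVectors n) :
    ‖WithLp.toLp 2 x‖ = √n := by
  rw [← Real.sqrt_sq (norm_nonneg _), norm_toLp_sq]
  simp [show ∀ i, ‖x i‖ = 1 from hx]

lemma star_dotProduct_self (x : Fin n → ℂ) :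
    star x ⬝ᵥ x = ((‖WithLp.toLp 2 x‖ ^ 2 : ℝ) : ℂ) := by
  rw [norm_toLp_sq]
  simp [dotProduct, Complex.conj_mul']

lemma star_dotProduct_mulVec_comm {M : Matrix (Fin n) (Fin n) ℂ} (hM : M.IsHermitian)
    (u v : Fin n → ℂ) : star u ⬝ᵥ (M *ᵥ v) = star (star v ⬝ᵥ (M *ᵥ u)) := by
  rw [Matrix.star_dotProduct, Matrix.star_mulVec, hM.eq, ← Matrix.dotProduct_mulVec]

lemma outer_isHermitian (z : Fin n → ℂ) : (outer z).IsHermitian := by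
  ext i j
  simp [outer, Matrix.vecMulVec_apply, mul_comm]

lemma dataMatrix_isHermitian (z : Fin n → ℂ) (σ : ℝ) {W : Matrix (Fin n) (Fin n) ℂ}
    (hW : W.IsHermitian) : (dataMatrix z σ W).IsHermitian := by
  refine (outer_isHermitian z).add ?_
  rw [Matrix.IsHermitian, Matrix.conjTranspose_smul, hW.eq]
  simp

lemma dataMatrix_mulVec (z : Fin n → ℂ) (σ : ℝ) (W : Matrix (Fin n) (Fin n) ℂ) (x : Fin n → ℂ)
    (i : Fin n) :
    (dataMatrix z σ W *ᵥ x) i = z i * (star z ⬝ᵥ x) + σ * (W *ᵥ x) i := by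
  simp [dataMatrix, Matrix.add_mulVec, Matrix.smul_mulVec, outer, Matrix.vecMulVec_mulVec,
    mul_comm]

lemma re_quadForm_dataMatrix (z : Fin n → ℂ) (σ : ℝ) (W : Matrix (Fin n) (Fin n) ℂ)
    (x : Fin n → ℂ) : (star x ⬝ᵥ (dataMatrix z σ W *ᵥ x)).re =
      ‖star z ⬝ᵥ x‖ ^ 2 + σ * (star x ⬝ᵥ (W *ᵥ x)).re := by
  have h : dataMatrix z σ W *ᵥ x = (star z ⬝ᵥ x) • z + (σ : ℂ) • (W *ᵥ x) := by
    ext i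
    rw [dataMatrix_mulVec]
    simp [mul_comm]
  have h2 : star x ⬝ᵥ z = star (star z ⬝ᵥ x) := Matrix.star_dotProduct _ _
  rw [h, dotProduct_add, dotProduct_smul, dotProduct_smul, h2, smul_eq_mul, smul_eq_mul,
    Complex.add_re, Complex.re_ofReal_mul, Complex.star_def, Complex.mul_conj,
    Complex.normSq_eq_norm_sq, Complex.ofReal_re]

lemma re_quadForm_add_single {M : Matrix (Fin n) (Fin n) ℂ} (hM : M.IsHermitian)
    (x : Fin n → ℂ) (i : Fin n) (s : ℂ) :
    (star (x + Pi.single i s) ⬝ᵥ (M *ᵥ (x + Pi.single i s))).re =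
      (star x ⬝ᵥ (M *ᵥ x)).re + 2 * (star s * (M *ᵥ x) i).re + (M i i).re * ‖s‖ ^ 2 := by
  have h1 : ∀ w : Fin n → ℂ, star (Pi.single i s : Fin n → ℂ) ⬝ᵥ w = star s * w i := by
    intro w
    rw [← Pi.single_star, single_dotProduct]
  have h2 : (star s * (M i i * s)).re = (M i i).re * ‖s‖ ^ 2 := by
    have : star s * (M i i * s) = M i i * ((‖s‖ ^ 2 : ℝ) : ℂ) := by
      rw [← Complex.normSq_eq_norm_sq, ← Complex.mul_conj]
      simp only [Complex.star_def]
      ring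
    rw [this, Complex.re_mul_ofReal]
  rw [star_add, Matrix.mulVec_add, add_dotProduct, dotProduct_add, dotProduct_add,
    star_dotProduct_mulVec_comm hM x (Pi.single i s), h1, h1]
  have h3 : (M *ᵥ Pi.single i s) i = M i i * s := by
    simp [Matrix.mulVec_single]
  rw [h3]
  simp only [Complex.add_re, h2]
  rw [Complex.star_def, Complex.conj_re]
  ring

lemma eq_norm_mul_of_norm_le_re {m x : ℂ} (hx : ‖x‖ = 1) (h : ‖m‖ ≤ (star x * m).re) :
    m = ‖m‖ * x := by
  have h1 : ‖star x * m‖ = ‖m‖ := by rw [norm_mul, norm_star, hx, one_mul]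
  have h2 : star x * m = ‖m‖ := by
    have h3 : (star x * m).re = ‖star x * m‖ :=
      le_antisymm (Complex.re_le_norm _) (h1.symm ▸ h)
    have h4 := Complex.re_eq_norm.mp h3
    rw [Complex.eq_coe_norm_of_nonneg h4, h1]
  calc m = (star x * m) * x := by
        have : star x * x = 1 := by
          rw [Complex.star_def, Complex.conj_mul', hx]; simp
        linear_combination (-m) * this
    _ = _ := by rw [h2]

/-- Optimality in each coordinate: `C x` is a nonnegative multiple of `x` in every entry. -/
lemma IsQPSolution.exists_mulVec_eq {C : Matrix (Fin n) (Fin n) ℂ} (hC : C.IsHermitian)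
    (hdiag : ∀ i, C i i = 1) {x : Fin n → ℂ} (hx : IsQPSolution C x) (i : Fin n) :
    ∃ d : ℝ, 0 ≤ d ∧ (C *ᵥ x) i = d * x i := by
  have hxi : ‖x i‖ = 1 := hx.1 i
  set m := (C *ᵥ x) i - x i with hm
  -- Replacing the phase `x i` by `p` changes the objective by an affine function of `p`: the
  -- diagonal contribution is constant, because `|p| = 1`. Maximality over all `p` then forces `m`
  -- to point along `x i`.
  have key : ∀ p : ℂ, ‖p‖ = 1 → (star p * m).re ≤ (star (x i) * m).re := by
    intro p hp
    have hmem : x + Pi.single i (p - x i) ∈ phaseVectors n := by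
      intro j
      by_cases hj : j = i
      · subst hj; simp [hp]
      · simpa [hj] using hx.1 j
    have h := hx.2 hmem
    simp only [Set.mem_ofPred_eq] at h
    rw [re_quadForm_add_single hC, hdiag, Complex.one_re, one_mul] at h
    have h2 : ‖p - x i‖ ^ 2 = 2 - 2 * (star p * x i).re := by
      have e1 : p.re ^ 2 + p.im ^ 2 = 1 := by
        have := Complex.sq_norm p
        rw [hp, Complex.normSq_apply] at this; linarith
      have e2 : (x i).re ^ 2 + (x i).im ^ 2 = 1 := by
        have := Complex.sq_norm (x i)
        rw [hxi, Complex.normSq_apply] at this; linarith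
      rw [Complex.sq_norm, Complex.normSq_apply]
      simp [Complex.mul_re]
      linarith
    have h3 : (star (x i) * x i).re = 1 := by
      rw [Complex.star_def, Complex.conj_mul', hxi]; simp
    rw [h2, star_sub, sub_mul, Complex.sub_re] at h
    rw [hm, mul_sub, mul_sub, Complex.sub_re, Complex.sub_re, h3]
    linarith
  have hmle : ‖m‖ ≤ (star (x i) * m).re := by
    by_cases h0 : m = 0
    · simp [h0]
    · have hne : ‖m‖ ≠ 0 := norm_ne_zero_iff.mpr h0
      have h := key (m / ‖m‖) (by simp [hne])
      have e : star (m / ‖m‖) * m = (‖m‖ : ℂ) := by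
        have hne' : (‖m‖ : ℂ) ≠ 0 := by exact_mod_cast hne
        rw [star_div₀, Complex.star_def, Complex.conj_ofReal, div_mul_eq_mul_div,
          Complex.conj_mul', div_eq_iff hne', sq]
      rwa [e, Complex.ofReal_re] at h
  refine ⟨1 + ‖m‖, by positivity, ?_⟩
  have := eq_norm_mul_of_norm_le_re hxi hmle
  push_cast
  linear_combination this + hm.symm

/-- The deterministic noise bounds used in the analysis of phase synchronization. -/
structure IsDiscordant (z : Fin n → ℂ) (W : Matrix (Fin n) (Fin n) ℂ) : Prop where
  norm_mulVec_le : ∀ u : Fin n → ℂ,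
    ‖WithLp.toLp 2 (W *ᵥ u)‖ ≤ 3 * √n * ‖WithLp.toLp 2 u‖
  norm_mulVec_apply_le : ∀ i, ‖(W *ᵥ z) i‖ ≤ 3 * √n * √(Real.log n)

lemma IsDiscordant.abs_re_le {z : Fin n → ℂ} {W : Matrix (Fin n) (Fin n) ℂ}
    (h : IsDiscordant z W) (u v : Fin n → ℂ) :
    |(star u ⬝ᵥ (W *ᵥ v)).re| ≤ 3 * √n * (‖WithLp.toLp 2 u‖ * ‖WithLp.toLp 2 v‖) := by
  calc _ ≤ ‖star u ⬝ᵥ (W *ᵥ v)‖ := Complex.abs_re_le_norm _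
    _ ≤ _ := norm_star_dotProduct_le _ _
    _ ≤ ‖WithLp.toLp 2 u‖ * (3 * √n * ‖WithLp.toLp 2 v‖) := by
      gcongr; exact h.norm_mulVec_le v
    _ = _ := by ring

section

variable {z x : Fin n → ℂ} {σ : ℝ} {W : Matrix (Fin n) (Fin n) ℂ}

lemma norm_sub_sq_of_star_dotProduct_eq (hz : z ∈ phaseVectors n) (hx : x ∈ phaseVectors n)
    (hzx : star z ⬝ᵥ x = ((‖star z ⬝ᵥ x‖ : ℝ) : ℂ)) :
    ‖WithLp.toLp 2 (x - z)‖ ^ 2 = 2 * n - 2 * ‖star z ⬝ᵥ x‖ := by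
  have h := norm_sub_sq (𝕜 := ℂ) (WithLp.toLp 2 x) (WithLp.toLp 2 z)
  rw [norm_toLp_of_mem_phaseVectors hx, norm_toLp_of_mem_phaseVectors hz,
    EuclideanSpace.inner_eq_star_dotProduct, ← WithLp.toLp_sub, Real.sq_sqrt (by positivity)] at h
  have h2 : z ⬝ᵥ star x = star (star z ⬝ᵥ x) := by
    rw [Matrix.star_dotProduct, star_star, dotProduct_comm]
  have h3 : RCLike.re (z ⬝ᵥ star x) = ‖star z ⬝ᵥ x‖ := by
    rw [h2, hzx]
    simp
  simp only [h3] at h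
  linarith

theorem norm_toLp_sub_le (hn : 0 < n) (hσ : 0 ≤ σ) (hz : z ∈ phaseVectors n) (hWH : W.IsHermitian)
    (hW : IsDiscordant z W) (hx : IsQPSolution (dataMatrix z σ W) x)
    (hzx : star z ⬝ᵥ x = ((‖star z ⬝ᵥ x‖ : ℝ) : ℂ)) :
    ‖WithLp.toLp 2 (x - z)‖ ≤ 12 * σ := by
  have h1 := norm_sub_sq_of_star_dotProduct_eq hz hx.1 hzx
  set g := ‖star z ⬝ᵥ x‖
  set e := ‖WithLp.toLp 2 (x - z)‖
  have hg : 0 ≤ g := norm_nonneg _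
  have he : 0 ≤ e := norm_nonneg _
  have h2 := hx.2 hz
  simp only [Set.mem_ofPred_eq] at h2
  rw [re_quadForm_dataMatrix, re_quadForm_dataMatrix, star_dotProduct_self,
    norm_toLp_of_mem_phaseVectors hz, Complex.norm_real, Real.sq_sqrt (by positivity)] at h2
  have h3 : (star x ⬝ᵥ (W *ᵥ x)).re - (star z ⬝ᵥ (W *ᵥ z)).re =
      (star (x - z) ⬝ᵥ (W *ᵥ (x + z))).re := by
    have := congrArg Complex.re (star_dotProduct_mulVec_comm hWH x z)
    rw [Complex.star_def, Complex.conj_re] at this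
    simp only [star_sub, sub_dotProduct, Matrix.mulVec_add, dotProduct_add, Complex.sub_re,
      Complex.add_re, this]
    ring
  have h4 : (star (x - z) ⬝ᵥ (W *ᵥ (x + z))).re ≤ 6 * n * e := by
    refine (le_abs_self _).trans ((hW.abs_re_le _ _).trans ?_)
    have h5 : ‖WithLp.toLp 2 (x + z)‖ ≤ 2 * √n := by
      rw [WithLp.toLp_add]
      refine (norm_add_le _ _).trans ?_
      rw [norm_toLp_of_mem_phaseVectors hx.1, norm_toLp_of_mem_phaseVectors hz]
      linarith
    calc _ ≤ 3 * √n * (e * (2 * √n)) := by gcongr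
      _ = 6 * (√n * √n) * e := by ring
      _ = _ := by rw [Real.mul_self_sqrt (by positivity)]
  have h6 : (n : ℝ) ^ 2 ≤ g ^ 2 + σ * (6 * n * e) := by
    have := mul_le_mul_of_nonneg_left (h3.le.trans h4) hσ
    simp only [Real.norm_eq_abs, Nat.abs_cast] at h2
    linarith
  have hn' : (0 : ℝ) < n := by exact_mod_cast hn
  -- Here `n² - g² = (n - g)(n + g) ≥ n e² / 2`, by `e² = 2(n - g)` and `g ≥ 0`.
  have h7 : n * (e * e) ≤ n * (12 * σ * e) := by nlinarith [sq_nonneg e]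
  have h8 := le_of_mul_le_mul_left h7 hn'
  rcases he.eq_or_lt with h0 | h0
  · rw [← h0]; positivity
  · exact le_of_mul_le_mul_right h8 h0

/-- The tail bound covers only the fixed vector `z`; the correction `W (x - z)` is bounded entrywise
by its 2-norm. -/
lemma norm_mulVec_apply_le (hn : 0 < n) (hσ : 0 ≤ σ) (hz : z ∈ phaseVectors n)
    (hWH : W.IsHermitian) (hW : IsDiscordant z W) (hx : IsQPSolution (dataMatrix z σ W) x)
    (hzx : star z ⬝ᵥ x = ((‖star z ⬝ᵥ x‖ : ℝ) : ℂ)) (i : Fin n) :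
    ‖(W *ᵥ x) i‖ ≤ 3 * √n * (√(Real.log n) + 12 * σ) := by
  have h1 : (W *ᵥ x) i = (W *ᵥ z) i + (W *ᵥ (x - z)) i := by
    rw [Matrix.mulVec_sub]; simp
  have h2 : ‖(W *ᵥ (x - z)) i‖ ≤ 3 * √n * (12 * σ) :=
    calc _ ≤ ‖WithLp.toLp 2 (W *ᵥ (x - z))‖ := PiLp.norm_apply_le (WithLp.toLp 2 _) i
      _ ≤ _ := hW.norm_mulVec_le _
      _ ≤ _ := by gcongr; exact norm_toLp_sub_le hn hσ hz hWH hW hx hzx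
  rw [h1]
  refine (norm_add_le _ _).trans ?_
  linarith [hW.norm_mulVec_apply_le i]

lemma le_norm_star_dotProduct (hn : 0 < n) (hσ : 0 ≤ σ) (hz : z ∈ phaseVectors n)
    (hWH : W.IsHermitian) (hW : IsDiscordant z W) (hx : IsQPSolution (dataMatrix z σ W) x)
    (hzx : star z ⬝ᵥ x = ((‖star z ⬝ᵥ x‖ : ℝ) : ℂ)) :
    n - 72 * σ ^ 2 ≤ ‖star z ⬝ᵥ x‖ := by
  have h1 := norm_sub_sq_of_star_dotProduct_eq hz hx.1 hzx
  have h2 := norm_toLp_sub_le hn hσ hz hWH hW hx hzx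
  have h3 := pow_le_pow_left₀ (norm_nonneg _) h2 2
  nlinarith

lemma dataMatrix_diag (hz : z ∈ phaseVectors n) (hd : ∀ i, W i i = 0) (i : Fin n) :
    dataMatrix z σ W i i = 1 := by
  have : ‖z i‖ = 1 := hz i
  simp [dataMatrix, hd, outer, Matrix.vecMulVec_apply, Complex.mul_conj, Complex.normSq_eq_norm_sq,
    this]

lemma IsQPSolution.exists_dataMatrix_mulVec_eq (hσ : 0 ≤ σ) (hz : z ∈ phaseVectors n)
    (hWH : W.IsHermitian) (hd : ∀ i, W i i = 0) (hx : IsQPSolution (dataMatrix z σ W) x)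
    (hzx : star z ⬝ᵥ x = ((‖star z ⬝ᵥ x‖ : ℝ) : ℂ)) :
    ∃ d : Fin n → ℝ, (∀ i, (dataMatrix z σ W *ᵥ x) i = d i * x i) ∧
      ∀ i, |d i - ‖star z ⬝ᵥ x‖| ≤ σ * ‖(W *ᵥ x) i‖ := by
  choose d hd0 hdx using
    hx.exists_mulVec_eq (dataMatrix_isHermitian z σ hWH) (dataMatrix_diag hz hd)
  refine ⟨d, hdx, fun i => ?_⟩
  have h1 := dataMatrix_mulVec z σ W x i
  rw [hdx i, hzx] at h1
  have hzi : ‖z i‖ = 1 := hz i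
  have hxi : ‖x i‖ = 1 := hx.1 i
  have h2 : |‖(d i : ℂ) * x i‖ - ‖z i * ((‖star z ⬝ᵥ x‖ : ℝ) : ℂ)‖| ≤ ‖(σ : ℂ) * (W *ᵥ x) i‖ := by
    refine (abs_norm_sub_norm_le _ _).trans_eq ?_
    rw [h1]; congr 1; ring
  rwa [norm_mul, norm_mul, norm_mul, Complex.norm_real, Complex.norm_real, Complex.norm_real,
    hzi, hxi, mul_one, one_mul, Real.norm_of_nonneg (hd0 i), norm_norm, Real.norm_of_nonneg hσ] at h2

theorem supNorm_sub_le (hn : 16 ≤ n) (hlog : √(Real.log n) ≤ 5 / 12 * √n) (hσ : 0 ≤ σ)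
    (hz : z ∈ phaseVectors n) (hWH : W.IsHermitian) (hd : ∀ i, W i i = 0)
    (hW : IsDiscordant z W) (hx : IsQPSolution (dataMatrix z σ W) x)
    (hzx : star z ⬝ᵥ x = ((‖star z ⬝ᵥ x‖ : ℝ) : ℂ)) :
    ‖x - z‖ ≤ 6 * (√(Real.log n) + 29 * σ) * σ * (n : ℝ) ^ (-(1 / 2 : ℝ)) := by
  have hn0 : 0 < n := by omega
  have hr4 : 4 ≤ √(n : ℝ) := Real.le_sqrt_of_sq_le (by norm_num; exact_mod_cast hn)
  have hrn : √(n : ℝ) ^ 2 = n := Real.sq_sqrt (by positivity)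
  have hpow : (n : ℝ) ^ (-(1 / 2 : ℝ)) = (√(n : ℝ))⁻¹ := by
    rw [Real.rpow_neg (by positivity), Real.sqrt_eq_rpow]
  have hL : 0 ≤ √(Real.log n) := Real.sqrt_nonneg _
  have hg := le_norm_star_dotProduct hn0 hσ hz hWH hW hx hzx
  have hWx := norm_mulVec_apply_le hn0 hσ hz hWH hW hx hzx
  obtain ⟨d, hdx, hdg⟩ := hx.exists_dataMatrix_mulVec_eq hσ hz hWH hd hzx
  rw [pi_norm_le_iff_of_nonneg (by positivity)]
  intro i
  rw [hpow, ← div_eq_mul_inv, le_div_iff₀ (by linarith), Pi.sub_apply]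
  have hzi : ‖z i‖ = 1 := hz i
  have hxi : ‖x i‖ = 1 := hx.1 i
  set L := √(Real.log n)
  set r := √(n : ℝ)
  set g := ‖star z ⬝ᵥ x‖
  -- For `σ` above `√n / 12` the trivial bound `|x_i - z_i| ≤ 2` is enough. Below it, `g ≥ n - 72σ²
  -- ≥ n / 2` allows division by `g`.
  rcases le_or_gt σ (r / 12) with hs | hs
  · have h1 : ‖x i - z i‖ * g ≤ 2 * (σ * ‖(W *ᵥ x) i‖) := by
      have e : (x i - z i) * (g : ℂ) = ((g - d i : ℝ) : ℂ) * x i + (σ : ℂ) * (W *ᵥ x) i := by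
        have h1 := dataMatrix_mulVec z σ W x i
        rw [hdx i, hzx] at h1
        push_cast
        linear_combination h1
      have h2 := norm_add_le (((g - d i : ℝ) : ℂ) * x i) ((σ : ℂ) * (W *ᵥ x) i)
      rw [← e, norm_mul, norm_mul, norm_mul, hxi, Complex.norm_real, Complex.norm_real,
        Complex.norm_real, Real.norm_of_nonneg hσ, Real.norm_of_nonneg (norm_nonneg _),
        Real.norm_eq_abs, abs_sub_comm] at h2
      linarith [hdg i]
    have h2 : ‖x i - z i‖ * (r ^ 2 - 72 * σ ^ 2) ≤ 6 * σ * (L + 12 * σ) * r := by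
      calc _ ≤ ‖x i - z i‖ * g := by
            gcongr; rw [hrn]; exact hg
        _ ≤ _ := h1
        _ ≤ 2 * (σ * (3 * r * (L + 12 * σ))) := by gcongr; exact hWx i
        _ = _ := by ring
    have hσr : σ ^ 2 ≤ r ^ 2 / 144 := by nlinarith
    have hpos : 0 < r ^ 2 - 72 * σ ^ 2 := by nlinarith
    have hσL : σ * L ≤ r / 12 * (5 / 12 * r) := by gcongr
    -- The constant 29 is exactly what absorbs the loss: with `σL ≤ 5r²/144` and `σ² ≤ r²/144`, the
    -- terms `72σL` and `72 · 29σ²` are at most `2.5r²` and `14.5r²`, which sum to `17r² = (29 -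
    -- 12)r²`.
    have h3 : (L + 12 * σ) * r ^ 2 ≤ (L + 29 * σ) * (r ^ 2 - 72 * σ ^ 2) := by
      have : 0 ≤ σ * (17 * r ^ 2 - 72 * (σ * L) - 2088 * σ ^ 2) := by
        apply mul_nonneg hσ; nlinarith
      nlinarith
    refine le_of_mul_le_mul_right ?_ hpos
    calc ‖x i - z i‖ * r * (r ^ 2 - 72 * σ ^ 2)
        = ‖x i - z i‖ * (r ^ 2 - 72 * σ ^ 2) * r := by ring
      _ ≤ 6 * σ * (L + 12 * σ) * r * r := by gcongr
      _ = 6 * σ * ((L + 12 * σ) * r ^ 2) := by ring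
      _ ≤ 6 * σ * ((L + 29 * σ) * (r ^ 2 - 72 * σ ^ 2)) := by gcongr
      _ = _ := by ring
  · have h1 : ‖x i - z i‖ ≤ 2 := by
      refine (norm_sub_le _ _).trans ?_
      rw [hzi, hxi]; norm_num
    calc ‖x i - z i‖ * r ≤ 2 * r := by gcongr
      _ ≤ 6 * (29 * (r / 12)) * (r / 12) := by nlinarith
      _ ≤ 6 * (29 * σ) * σ := by gcongr
      _ ≤ _ := by gcongr; linarith

end

end AngularSync

/-! ### Dual certificate and tightness of (SDP) -/

namespace AngularSync

variable {n : ℕ}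

lemma exists_eq_conjTranspose_mul_self {X : Matrix (Fin n) (Fin n) ℂ} (hX : X.PosSemidef) :
    ∃ B : Matrix (Fin n) (Fin n) ℂ, X = Bᴴ * B := by
  open scoped MatrixOrder Matrix.Norms.L2Operator in
  exact CStarAlgebra.nonneg_iff_eq_star_mul_self.mp hX.nonneg

lemma outer_mem_sdpFeasible {x : Fin n → ℂ} (hx : x ∈ phaseVectors n) :
    outer x ∈ sdpFeasible n := by
  refine ⟨Matrix.posSemidef_vecMulVec_self_star x, fun i => ?_⟩
  have : ‖x i‖ = 1 := hx i
  simp [outer, Matrix.vecMulVec_apply, Complex.mul_conj, Complex.normSq_eq_norm_sq, this]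

lemma rank_outer (hn : 0 < n) {x : Fin n → ℂ} (hx : x ∈ phaseVectors n) :
    (outer x).rank = 1 := by
  refine le_antisymm (Matrix.rank_vecMulVec_le _ _) (Nat.one_le_iff_ne_zero.mpr fun h => ?_)
  rw [Matrix.rank, Submodule.finrank_eq_zero, LinearMap.range_eq_bot] at h
  have h1 := (outer_mem_sdpFeasible hx).2 ⟨0, hn⟩
  have h2 := congrFun (LinearMap.congr_fun h (Pi.single ⟨0, hn⟩ 1)) ⟨0, hn⟩
  simp [h1] at h2

lemma trace_mul_conjTranspose_mul_self (S B : Matrix (Fin n) (Fin n) ℂ) :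
    (S * (Bᴴ * B)).trace = ∑ k, star (star (B k)) ⬝ᵥ (S *ᵥ star (B k)) := by
  rw [← Matrix.mul_assoc, Matrix.trace_mul_comm]
  refine Finset.sum_congr rfl fun k _ => ?_
  rw [star_star]
  rfl

section Certificate

variable {C : Matrix (Fin n) (Fin n) ℂ} {x : Fin n → ℂ} {d : Fin n → ℝ} {γ : ℝ}

/-- Subtracting from `b` its component along `x` does not change the form, since the Hermitian
matrix `diag d - C` kills `x`. -/
lemma dual_quadForm_ge (hn : 0 < n) (hC : C.IsHermitian) (hx : x ∈ phaseVectors n)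
    (hdx : ∀ i, (C *ᵥ x) i = d i * x i)
    (hgap : ∀ v, star x ⬝ᵥ v = 0 → γ * ‖WithLp.toLp 2 v‖ ^ 2 ≤
      (star v ⬝ᵥ ((Matrix.diagonal (fun i => (d i : ℂ)) - C) *ᵥ v)).re)
    (b : Fin n → ℂ) :
    ∃ c : ℂ, γ * ‖WithLp.toLp 2 (b - c • x)‖ ^ 2 ≤
      (star b ⬝ᵥ ((Matrix.diagonal (fun i => (d i : ℂ)) - C) *ᵥ b)).re := by
  set S := Matrix.diagonal (fun i => (d i : ℂ)) - C with hS_def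
  have hS : S.IsHermitian := by
    refine Matrix.IsHermitian.sub ?_ hC
    refine Matrix.isHermitian_diagonal_of_self_adjoint _ ?_
    ext i
    simp
  have hSx : S *ᵥ x = 0 := by
    ext i
    simp [hS_def, Matrix.sub_mulVec, Matrix.mulVec_diagonal, hdx]
  have hxx : star x ⬝ᵥ x = n := by
    rw [star_dotProduct_self, norm_toLp_of_mem_phaseVectors hx, Real.sq_sqrt (by positivity)]
    simp
  have hn' : (n : ℂ) ≠ 0 := by exact_mod_cast hn.ne'
  set c := (star x ⬝ᵥ b) / n with hc
  set v := b - c • x with hv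
  have hxv : star x ⬝ᵥ v = 0 := by
    rw [hv, dotProduct_sub, dotProduct_smul, hxx, hc, smul_eq_mul, div_mul_cancel₀ _ hn', sub_self]
  refine ⟨c, (hgap v hxv).trans_eq ?_⟩
  have hb : b = v + c • x := by rw [hv]; abel
  have h1 : S *ᵥ b = S *ᵥ v := by
    rw [hb, Matrix.mulVec_add, Matrix.mulVec_smul, hSx, smul_zero, add_zero]
  have h2 : star x ⬝ᵥ (S *ᵥ v) = 0 := by
    rw [star_dotProduct_mulVec_comm hS, hSx, dotProduct_zero, star_zero]
  rw [h1]
  conv_rhs => rw [hb, star_add, add_dotProduct, star_smul, smul_dotProduct, h2, smul_zero, add_zero]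

/-- The rank-one matrix `x x*` is the unique solution of (SDP) as soon as the dual certificate
`diag d - C` annihilates `x` and is positive definite on its orthogonal complement. -/
theorem isSDPSolution_iff_eq_outer (hn : 0 < n) (hC : C.IsHermitian) (hx : x ∈ phaseVectors n)
    (hdx : ∀ i, (C *ᵥ x) i = d i * x i) (hγ : 0 < γ)
    (hgap : ∀ v, star x ⬝ᵥ v = 0 → γ * ‖WithLp.toLp 2 v‖ ^ 2 ≤
      (star v ⬝ᵥ ((Matrix.diagonal (fun i => (d i : ℂ)) - C) *ᵥ v)).re)
    (X : Matrix (Fin n) (Fin n) ℂ) : IsSDPSolution C X ↔ X = outer x := by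
  -- The unit diagonal makes `trace (diag d * Y)` constant, so maximizing `trace (C Y)` amounts to
  -- minimizing `trace (S Y)`.
  have hobj : ∀ Y ∈ sdpFeasible n, (C * Y).trace.re = ∑ i, d i -
      ((Matrix.diagonal (fun i => (d i : ℂ)) - C) * Y).trace.re := by
    intro Y hY
    have : (Matrix.diagonal (fun i => (d i : ℂ)) * Y).trace = ∑ i, (d i : ℂ) := by
      simp [Matrix.trace, Matrix.diagonal_mul, hY.2]
    rw [Matrix.sub_mul, Matrix.trace_sub, this, Complex.sub_re, Complex.re_sum]
    simp
  set S := Matrix.diagonal (fun i => (d i : ℂ)) - C with hS_def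
  have hcert := dual_quadForm_ge hn hC hx hdx hgap
  rw [← hS_def] at hcert
  choose c hc using hcert
  have hSx : S *ᵥ x = 0 := by
    ext i
    simp [hS_def, Matrix.sub_mulVec, Matrix.mulVec_diagonal, hdx]
  have houter : (S * outer x).trace = 0 := by
    rw [outer, Matrix.mul_vecMulVec, hSx]
    simp
  have htr : ∀ B : Matrix (Fin n) (Fin n) ℂ,
      γ * ∑ k, ‖WithLp.toLp 2 (star (B k) - c (star (B k)) • x)‖ ^ 2 ≤
        (S * (Bᴴ * B)).trace.re := by
    intro B
    rw [trace_mul_conjTranspose_mul_self, Complex.re_sum, Finset.mul_sum]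
    exact Finset.sum_le_sum fun k _ => hc (star (B k))
  constructor
  · rintro ⟨hX, hmax⟩
    obtain ⟨B, rfl⟩ := exists_eq_conjTranspose_mul_self hX.1
    have h1 := hmax (outer_mem_sdpFeasible hx)
    simp only [Set.mem_ofPred_eq] at h1
    rw [hobj _ hX, hobj _ (outer_mem_sdpFeasible hx), houter, Complex.zero_re] at h1
    have h2 := htr B
    have h3 : ∑ k, ‖WithLp.toLp 2 (star (B k) - c (star (B k)) • x)‖ ^ 2 = 0 := by
      refine le_antisymm ?_ (by positivity)
      by_contra hlt
      have := mul_pos hγ (not_le.mp hlt)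
      linarith
    rw [Finset.sum_eq_zero_iff_of_nonneg (fun _ _ => by positivity)] at h3
    -- Zero trace forces every conjugated row of `B` to be a multiple of `x`; hence `Bᴴ * B` is a
    -- multiple of `outer x`, and the unit diagonal makes the factor 1.
    have h4 : ∀ k i, star (B k i) = c (star (B k)) * x i := by
      intro k i
      have h5 := h3 k (Finset.mem_univ k)
      rw [sq_eq_zero_iff, norm_eq_zero, WithLp.toLp_eq_zero, sub_eq_zero] at h5
      exact congrFun h5 i
    have h5 : ∀ i j, (Bᴴ * B) i j =
        (∑ k, c (star (B k)) * star (c (star (B k)))) * outer x i j := by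
      intro i j
      rw [Matrix.mul_apply, Finset.sum_mul]
      refine Finset.sum_congr rfl fun k _ => ?_
      rw [Matrix.conjTranspose_apply, h4, ← star_star (B k j), h4, star_mul', outer,
        Matrix.vecMulVec_apply, Pi.star_apply]
      ring
    have h6 := h5 ⟨0, hn⟩ ⟨0, hn⟩
    rw [hX.2, (outer_mem_sdpFeasible hx).2, mul_one] at h6
    ext i j
    rw [h5, ← h6, one_mul]
  · rintro rfl
    refine ⟨outer_mem_sdpFeasible hx, fun Y hY => ?_⟩
    simp only [Set.mem_ofPred_eq]
    rw [hobj _ hY, hobj _ (outer_mem_sdpFeasible hx), houter, Complex.zero_re]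
    obtain ⟨B, rfl⟩ := exists_eq_conjTranspose_mul_self hY.1
    have := (mul_nonneg hγ.le (Finset.sum_nonneg fun k _ => by positivity)).trans (htr B)
    linarith

end Certificate

section

variable {z x : Fin n → ℂ} {σ : ℝ} {W : Matrix (Fin n) (Fin n) ℂ}

/-- With `s = n^(1/4)`, the term `36σ²√n` is of the same order `s⁴` as `n` when `σ` is of order `s`;
this sets the threshold. The subtracted terms total at most `(19/36) s⁴`, using `log n = 4 log s ≤
4(s - 1) ≤ s²` and `s ≥ 2`. -/
lemma spectral_gap_pos (hn : 16 ≤ n) (hσ : 0 ≤ σ) (hσn : σ ≤ 1 / 18 * (n : ℝ) ^ (1 / 4 : ℝ)) :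
    0 < n - 72 * σ ^ 2 - σ * (3 * √n * (√(Real.log n) + 12 * σ)) - 144 * σ ^ 2 - 3 * √n * σ := by
  have hn0 : (0 : ℝ) < n := by exact_mod_cast (by omega : 0 < n)
  set s := (n : ℝ) ^ (1 / 4 : ℝ) with hs
  have hs0 : 0 < s := Real.rpow_pos_of_pos hn0 _
  have hs4 : s ^ 4 = n := by
    rw [hs, ← Real.rpow_natCast, ← Real.rpow_mul hn0.le]; norm_num
  have hr : √(n : ℝ) = s ^ 2 := by
    rw [← hs4, show s ^ 4 = (s ^ 2) ^ 2 by ring, Real.sqrt_sq (by positivity)]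
  have hs2 : 2 ≤ s := by
    refine le_of_pow_le_pow_left₀ (n := 4) (by norm_num) hs0.le ?_
    rw [hs4]; norm_num; exact_mod_cast hn
  have hL : √(Real.log n) ≤ s := by
    refine Real.sqrt_le_iff.mpr ⟨hs0.le, ?_⟩
    rw [← hs4, Real.log_pow]
    have := Real.log_le_sub_one_of_pos hs0
    push_cast
    nlinarith [sq_nonneg (s - 2)]
  have hL0 := Real.sqrt_nonneg (Real.log n)
  rw [hr]
  have h1 : σ ^ 2 ≤ (1 / 18 * s) ^ 2 := by gcongr
  have h2 : σ * (3 * s ^ 2 * (√(Real.log n) + 12 * σ)) ≤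
      1 / 18 * s * (3 * s ^ 2 * (s + 12 * (1 / 18 * s))) := by gcongr
  have h3 : 3 * s ^ 2 * σ ≤ 3 * s ^ 2 * (1 / 18 * s) := by gcongr
  have h4 : 2 * s ^ 3 ≤ s ^ 4 := by
    rw [pow_succ s 3, mul_comm]; gcongr
  have h5 : 4 * s ^ 2 ≤ s ^ 4 := by
    rw [show s ^ 4 = s ^ 2 * s ^ 2 by ring]; gcongr; nlinarith
  have h6 : 0 < s ^ 4 := by positivity
  linarith

theorem isSDPSolution_dataMatrix_iff (hn : 16 ≤ n) (hσ : 0 ≤ σ)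
    (hσn : σ ≤ 1 / 18 * (n : ℝ) ^ (1 / 4 : ℝ)) (hz : z ∈ phaseVectors n) (hWH : W.IsHermitian)
    (hd : ∀ i, W i i = 0) (hW : IsDiscordant z W) (hx : IsQPSolution (dataMatrix z σ W) x)
    (hzx : star z ⬝ᵥ x = ((‖star z ⬝ᵥ x‖ : ℝ) : ℂ)) (X : Matrix (Fin n) (Fin n) ℂ) :
    IsSDPSolution (dataMatrix z σ W) X ↔ X = outer x := by
  have hn0 : 0 < n := by omega
  have hg := le_norm_star_dotProduct hn0 hσ hz hWH hW hx hzx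
  have hl2 := norm_toLp_sub_le hn0 hσ hz hWH hW hx hzx
  obtain ⟨d, hdx, hdg⟩ := hx.exists_dataMatrix_mulVec_eq hσ hz hWH hd hzx
  refine isSDPSolution_iff_eq_outer hn0 (dataMatrix_isHermitian z σ hWH) hx.1 hdx
    (spectral_gap_pos hn hσ hσn) (fun v hv => ?_) X
  -- Orthogonality to `x` makes the signal part `|z*v|²` cost only `144σ²‖v‖²`.
  have h1 : ‖star z ⬝ᵥ v‖ ≤ 12 * σ * ‖WithLp.toLp 2 v‖ := by
    have : star z ⬝ᵥ v = - (star (x - z) ⬝ᵥ v) := by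
      rw [star_sub, sub_dotProduct, hv]; ring
    rw [this, norm_neg]
    refine (norm_star_dotProduct_le _ _).trans ?_
    gcongr
  have h2 := mul_le_mul_of_nonneg_left ((le_abs_self _).trans (hW.abs_re_le v v)) hσ
  have h3 : (star v ⬝ᵥ (Matrix.diagonal (fun i => (d i : ℂ)) *ᵥ v)).re =
      ∑ i, d i * ‖v i‖ ^ 2 := by
    rw [dotProduct, Complex.re_sum]
    refine Finset.sum_congr rfl fun i _ => ?_
    rw [Matrix.mulVec_diagonal, Pi.star_apply, Complex.star_def, mul_left_comm,
      Complex.re_ofReal_mul, Complex.conj_mul', ← Complex.ofReal_pow, Complex.ofReal_re]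
  have h4 : (n - 72 * σ ^ 2 - σ * (3 * √n * (√(Real.log n) + 12 * σ))) *
      ‖WithLp.toLp 2 v‖ ^ 2 ≤ ∑ i, d i * ‖v i‖ ^ 2 := by
    rw [norm_toLp_sq, Finset.mul_sum]
    refine Finset.sum_le_sum fun i _ => ?_
    gcongr
    have h5 := (abs_le.mp (hdg i)).1
    have h6 := mul_le_mul_of_nonneg_left (norm_mulVec_apply_le hn0 hσ hz hWH hW hx hzx i) hσ
    linarith
  have h5 := pow_le_pow_left₀ (norm_nonneg _) h1 2
  rw [Matrix.sub_mulVec, dotProduct_sub, Complex.sub_re, h3, re_quadForm_dataMatrix]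
  nlinarith

end

/-! ### Probability of the noise bounds and conclusion -/

section Probability

variable {Ω : Type*} [MeasurableSpace Ω] {μ : Measure Ω} {W : Ω → Matrix (Fin n) (Fin n) ℂ}

lemma exp_neg_two_point_eight_eight_le : Real.exp (-2.88) ≤ 0.07 := by
  refine le_of_pow_le_pow_left₀ (n := 4) (by norm_num) (by norm_num) ?_
  calc Real.exp (-2.88) ^ 4 = Real.exp (-11.52) := by rw [← Real.exp_nat_mul]; norm_num
    _ ≤ Real.exp (-11) := Real.exp_le_exp.mpr (by norm_num)
    _ = Real.exp (-1) ^ 11 := by rw [← Real.exp_nat_mul]; norm_num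
    _ ≤ 0.3678794412 ^ 11 := by gcongr; exact Real.exp_neg_one_lt_d9.le
    _ ≤ _ := by norm_num

lemma IsGaussianWigner.measureReal_not_isDiscordant_le [IsProbabilityMeasure μ] (hn : 0 < n)
    (hn1 : 2 * (0.0783 / 0.0784 : ℝ) ^ n ≤ 1 / 2)
    (hn2 : (n : ℝ) ^ 2 * (0.07 / 0.0784) ^ n ≤ 1 / 4)
    (hW : IsGaussianWigner μ W) {z : Fin n → ℂ} (hz : z ∈ phaseVectors n) :
    μ.real {ω | ¬ IsDiscordant z (W ω)} ≤ 5 * (n : ℝ) ^ (-(5 / 4 : ℝ)) := by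
  have hn' : (0 : ℝ) < n := by exact_mod_cast hn
  have hn1' : (1 : ℝ) ≤ n := by exact_mod_cast hn
  have hrn : √(n : ℝ) ^ 2 = n := Real.sq_sqrt hn'.le
  -- Here `2.4 = 0.8 · 3`, and the tail `exp(-2.4² n / 2) = exp(-2.88 n) ≤ 0.07 ^ n` beats the
  -- volume fraction, about `0.0784 ^ n`.
  have hop : μ.real {ω | ∃ u, 2.4 * √n * ‖u‖ < 0.8 * ‖Matrix.toEuclideanLin (W ω) u‖} ≤
      (n : ℝ) ^ (-(5 / 4 : ℝ)) := by
    have h := hW.measureReal_norm_gt_le hn (t := 2.4 * √n) (by positivity)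
    set P := μ.real {ω | ∃ u, 2.4 * √n * ‖u‖ < 0.8 * ‖Matrix.toEuclideanLin (W ω) u‖}
    have hP : 0 ≤ P := measureReal_nonneg
    have h1 : Real.exp (-(2.4 * √n) ^ 2 / 2) ≤ 0.07 ^ n := by
      have : -(2.4 * √(n : ℝ)) ^ 2 / 2 = n * (-2.88) := by
        rw [mul_pow, hrn]; ring
      rw [this, Real.exp_nat_mul]
      gcongr
      exact exp_neg_two_point_eight_eight_le
    have h2 : (0.0784 : ℝ) ^ n / 2 ≤ 0.0784 ^ n - 2 * 0.0783 ^ n := by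
      rw [div_pow, mul_div_assoc', div_le_iff₀ (by positivity)] at hn1
      linarith
    have h3 : (0.0784 : ℝ) ^ n / 2 * P ≤ 2 * 0.07 ^ n :=
      (mul_le_mul_of_nonneg_right h2 hP).trans (h.trans (by gcongr))
    rw [div_pow, mul_div_assoc', div_le_iff₀ (by positivity)] at hn2
    have h4 : (n : ℝ) ^ 2 * P ≤ 1 := by
      have hp : (0 : ℝ) < 0.0784 ^ n := by positivity
      refine le_of_mul_le_mul_left ?_ hp
      have := mul_le_mul_of_nonneg_left h3 (sq_nonneg (n : ℝ))
      linarith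
    calc P ≤ (n : ℝ) ^ (-2 : ℝ) := by
          rw [Real.rpow_neg hn'.le, Real.rpow_two, ← one_div, le_div_iff₀ (by positivity)]
          linarith
      _ ≤ _ := Real.rpow_le_rpow_of_exponent_le hn1' (by norm_num)
  -- The exponent is `9 log n / 4`; the union over `n` coordinates costs one power of `n` and leaves
  -- `n^(-5/4)`.
  have hinf : ∀ i, μ.real {ω | 3 * √n * √(Real.log n) < ‖(W ω *ᵥ z) i‖} ≤
      4 * (n : ℝ) ^ (-(9 / 4 : ℝ)) := by
    intro i
    have h := hW.measureReal_norm_mulVec_gt_le hz i (t := 3 * √n * √(Real.log n)) (by positivity)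
    have h1 : -(3 * √n * √(Real.log n)) ^ 2 / (4 * n) = Real.log n * (-(9 / 4)) := by
      rw [mul_pow, mul_pow, hrn, Real.sq_sqrt (Real.log_nonneg hn1')]
      field_simp
      ring
    rwa [h1, ← Real.rpow_def_of_pos hn'] at h
  have hsub : {ω | ¬ IsDiscordant z (W ω)} ⊆
      {ω | ∃ u, 2.4 * √n * ‖u‖ < 0.8 * ‖Matrix.toEuclideanLin (W ω) u‖} ∪
      ⋃ i, {ω | 3 * √n * √(Real.log n) < ‖(W ω *ᵥ z) i‖} := by
    intro ω hω
    by_contra hcon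
    simp only [Set.mem_union, Set.mem_iUnion, Set.mem_ofPred_eq, not_or, not_exists, not_lt]
      at hcon
    refine hω ⟨fun u => ?_, hcon.2⟩
    have h := hcon.1 (WithLp.toLp 2 u)
    rw [Matrix.toLpLin_toLp, Matrix.toLin'_apply] at h
    linarith
  have hsum : ∑ _i : Fin n, 4 * (n : ℝ) ^ (-(9 / 4 : ℝ)) = 4 * (n : ℝ) ^ (-(5 / 4 : ℝ)) := by
    rw [Finset.sum_const, Finset.card_univ, Fintype.card_fin, nsmul_eq_mul, mul_left_comm]
    congr 1
    rw [← Real.rpow_one_add' hn'.le (by norm_num)]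
    norm_num
  calc _ ≤ _ := measureReal_mono hsub
    _ ≤ _ := measureReal_union_le _ _
    _ ≤ _ := add_le_add_right (measureReal_iUnion_fintype_le _) _
    _ ≤ (n : ℝ) ^ (-(5 / 4 : ℝ)) + ∑ _i : Fin n, 4 * (n : ℝ) ^ (-(9 / 4 : ℝ)) :=
      add_le_add hop (Finset.sum_le_sum fun i _ => hinf i)
    _ = _ := by rw [hsum]; ring

end Probability

lemma eventually_pow_bounds : ∀ᶠ n : ℕ in Filter.atTop,
    34 ≤ n ∧ 2 * (0.0783 / 0.0784 : ℝ) ^ n ≤ 1 / 2 ∧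
      (n : ℝ) ^ 2 * (0.07 / 0.0784) ^ n ≤ 1 / 4 := by
  have h1 := (tendsto_pow_atTop_nhds_zero_of_lt_one (r := (0.0783 / 0.0784 : ℝ)) (by norm_num)
    (by norm_num)).eventually (ge_mem_nhds (show (0 : ℝ) < 1 / 4 by norm_num))
  have h2 := (tendsto_pow_const_mul_const_pow_of_abs_lt_one 2 (r := (0.07 / 0.0784 : ℝ))
    (by rw [abs_of_pos] <;> norm_num)).eventually
    (ge_mem_nhds (show (0 : ℝ) < 1 / 4 by norm_num))
  filter_upwards [Filter.eventually_ge_atTop 34, h1, h2] with n hn h1 h2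
  exact ⟨hn, by linarith, h2⟩

/-- As `log n ≤ √n`, it suffices that `√n ≤ (25/144) n`, that is `√n ≥ 5.76`, which `n ≥ 34`
ensures. -/
lemma sqrt_log_le (n : ℕ) (hn : 34 ≤ n) : √(Real.log n) ≤ 5 / 12 * √n := by
  have hn' : (34 : ℝ) ≤ n := by exact_mod_cast hn
  have hr : √(n : ℝ) ^ 2 = n := Real.sq_sqrt (by positivity)
  refine Real.sqrt_le_iff.mpr ⟨by positivity, ?_⟩
  have h1 : Real.log n = 4 * Real.log (√(√n)) := by
    rw [Real.log_sqrt (by positivity), Real.log_sqrt (by positivity)]; ring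
  have hs : 0 < √(√(n : ℝ)) := Real.sqrt_pos.mpr (Real.sqrt_pos.mpr (by linarith))
  have h2 := Real.log_le_sub_one_of_pos hs
  have h3 : √(√(n : ℝ)) ^ 2 = √n := Real.sq_sqrt (by positivity)
  have h4 : 5.76 ≤ √(n : ℝ) := by
    refine Real.le_sqrt_of_sq_le (by norm_num; linarith)
  nlinarith [sq_nonneg (√(√(n : ℝ)) - 2)]

end AngularSync

open AngularSync in
theorem theorem1 :
    ∃ K : ℝ, ∀ (n : ℕ), 2 ≤ n → ∀ (z : Fin n → ℂ), (∀ i, ‖z i‖ = 1) →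
      ∀ (σ : ℝ), 0 ≤ σ →
      ∀ (Ω : Type*) [MeasurableSpace Ω] (μ : Measure Ω) [IsProbabilityMeasure μ]
        (W : Ω → Matrix (Fin n) (Fin n) ℂ), AngularSync.IsGaussianWigner μ W →
      ∃ E : Set Ω, MeasurableSet E ∧ 1 - K * (n : ℝ) ^ (-(5 / 4 : ℝ)) ≤ μ.real E ∧
        ∀ ω ∈ E, ∀ x : Fin n → ℂ,
          AngularSync.IsQPSolution (AngularSync.dataMatrix z σ (W ω)) x →
          star z ⬝ᵥ x = ((‖star z ⬝ᵥ x‖ : ℝ) : ℂ) →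
          -- the norm on `Fin n → ℂ` is the sup norm
          ‖x - z‖ ≤ 6 * (√(Real.log n) + 29 * σ) * σ * (n : ℝ) ^ (-(1 / 2 : ℝ)) ∧
          ‖(WithLp.toLp 2 (x - z) : EuclideanSpace ℂ (Fin n))‖ ≤ 12 * σ ∧
          (σ ≤ (1 / 18 : ℝ) * (n : ℝ) ^ (1 / 4 : ℝ) →
            (AngularSync.outer x).rank = 1 ∧
            ∀ X : Matrix (Fin n) (Fin n) ℂ,
              AngularSync.IsSDPSolution (AngularSync.dataMatrix z σ (W ω)) X ↔
                X = AngularSync.outer x) := by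
  obtain ⟨N, hN⟩ := Filter.eventually_atTop.mp eventually_pow_bounds
  -- The term `N^(5/4)` makes the probability bound vacuous for `n < N`, where the empty event
  -- serves.
  refine ⟨max 5 ((N : ℝ) ^ (5 / 4 : ℝ)), fun n hn2 z hz σ hσ Ω _ μ _ W hW => ?_⟩
  have hn0 : (0 : ℝ) < n := by exact_mod_cast (by omega : 0 < n)
  have hpow : 0 ≤ (n : ℝ) ^ (-(5 / 4 : ℝ)) := by positivity
  rcases lt_or_ge n N with hlt | hge
  · refine ⟨∅, MeasurableSet.empty, ?_, by simp⟩
    rw [measureReal_empty, sub_nonpos]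
    calc (1 : ℝ) = (n : ℝ) ^ (5 / 4 : ℝ) * (n : ℝ) ^ (-(5 / 4 : ℝ)) := by
          rw [← Real.rpow_add hn0]; norm_num
      _ ≤ (N : ℝ) ^ (5 / 4 : ℝ) * (n : ℝ) ^ (-(5 / 4 : ℝ)) := by gcongr
      _ ≤ _ := by gcongr; exact le_max_right _ _
  · obtain ⟨h34, hlarge1, hlarge2⟩ := hN n hge
    have hbad := hW.measureReal_not_isDiscordant_le (by omega) hlarge1 hlarge2 hz
    -- The failure event need not be measurable, so a measurable hull of the same measure is removed
    -- instead.
    refine ⟨(toMeasurable μ {ω | ¬ IsDiscordant z (W ω)})ᶜ,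
      (measurableSet_toMeasurable _ _).compl, ?_, fun ω hω x hx hzx => ?_⟩
    · rw [probReal_compl_eq_one_sub (measurableSet_toMeasurable _ _), measureReal_def,
        measure_toMeasurable, ← measureReal_def]
      have : 5 * (n : ℝ) ^ (-(5 / 4 : ℝ)) ≤
          max 5 ((N : ℝ) ^ (5 / 4 : ℝ)) * (n : ℝ) ^ (-(5 / 4 : ℝ)) := by
        gcongr; exact le_max_left _ _
      linarith
    · have hd : IsDiscordant z (W ω) := by
        by_contra hcon
        exact hω (subset_toMeasurable _ _ hcon)
      have hH := hW.isHermitian ω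
      have hdiag := hW.diag_eq_zero ω
      refine ⟨supNorm_sub_le (by omega) (sqrt_log_le n h34) hσ hz hH hdiag hd hx hzx,
        norm_toLp_sub_le (by omega) hσ hz hH hd hx hzx, fun hσn => ⟨rank_outer (by omega) hx.1,
          isSDPSolution_dataMatrix_iff (by omega) hσ hσn hz hH hdiag hd hx hzx⟩⟩
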